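/- Let $L$ be a finite-dimensional solvable Lie algebra over a field $F$. A chain $S_0<S_1<\dots<S_n=L$ of subalgebras in which each $S_i$ is a maximal subalgebra of $S_{i+1}$ is called a maximal chain, and the subalgebra $S_0$ in such a chain is called an $n$-maximal subalgebra of $L$. For a Lie algebra $S$, the Frattini ideal $\phi(S)$ is the largest ideal of $S$ contained in the intersection of the maximal subalgebras of $S$. Then every $3$-maximal subalgebra of $L$ is an ideal of $L$ if and only if one of the following holds: (i) $L$ is nilpotent and $\phi(K)=\phi(M)$ for every $2$-maximal subalgebra $K$ of $L$ and every maximal subalgebra $M$ of $L$ containing $K$; or (ii) $\dim L\le 3$. -/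

import Mathlib

/-- `S` is an `n`-maximal subalgebra of `L`: there is a chain `S = S₀ < S₁ < ⋯ < Sₙ = L` of
subalgebras in which each `Sᵢ` is a maximal subalgebra of `Sᵢ₊₁` (that is, `Sᵢ ⋖ Sᵢ₊₁` in the
lattice of subalgebras of `L`). -/
def IsNMaximalSubalgebra (F : Type*) {L : Type*} [Field F] [LieRing L] [LieAlgebra F L]
    (n : ℕ) (S : LieSubalgebra F L) : Prop :=
  ∃ c : Fin (n + 1) → LieSubalgebra F L,
    c 0 = S ∧ c (Fin.last n) = ⊤ ∧ ∀ i : Fin n, c i.castSucc ⋖ c i.succ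

/-- The intersection of the maximal subalgebras of `L` (equal to `L` if there are none, i.e. when
`L = 0` in the finite-dimensional case). -/
def maximalSubalgebrasInf (F L : Type*) [Field F] [LieRing L] [LieAlgebra F L] :
    LieSubalgebra F L :=
  sInf {M : LieSubalgebra F L | IsCoatom M}

/-- The Frattini ideal of `L`: the largest ideal of `L` contained in the intersection of the
maximal subalgebras of `L`. -/
def frattiniIdeal (F L : Type*) [Field F] [LieRing L] [LieAlgebra F L] : LieIdeal F L :=
  sSup {I : LieIdeal F L | LieIdeal.toLieSubalgebra F L I ≤ maximalSubalgebrasInf F L}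

/-- The defining property: `frattiniIdeal F L` is itself contained in the intersection of the
maximal subalgebras, so that it is indeed the largest such ideal. -/
theorem frattiniIdeal_isGreatest (F L : Type*) [Field F] [LieRing L] [LieAlgebra F L] :
    IsGreatest {I : LieIdeal F L | LieIdeal.toLieSubalgebra F L I ≤ maximalSubalgebrasInf F L}
      (frattiniIdeal F L) := by
  refine ⟨?_, fun I hI => le_sSup hI⟩
  have h : (frattiniIdeal F L).toSubmodule ≤ (maximalSubalgebrasInf F L).toSubmodule := by
    rw [frattiniIdeal, LieSubmodule.sSup_toSubmodule_eq_iSup]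
    exact iSup₂_le fun I hI => hI
  exact h

/-- The Frattini ideal `φ(S)` of a subalgebra `S` of `L` (an ideal of `S`, computed inside `S`),
regarded as a subalgebra of `L`. -/
def frattiniOf {F L : Type*} [Field F] [LieRing L] [LieAlgebra F L] (S : LieSubalgebra F L) :
    LieSubalgebra F L :=
  (LieIdeal.toLieSubalgebra F S (frattiniIdeal F S)).map S.incl

/-! Suppose that all 3-maximal subalgebras are ideals and `dim L ≥ 4`. An algebra covering two
distinct ideals is their sum, hence an ideal; with dimension counts this climbs from 3-maximal to
maximal subalgebras, and Engel's theorem gives nilpotency (`isNilpotent_of_three_maximal_isIdeal`).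
In a nilpotent algebra covers have codimension 1 and `φ(K) = [K,K]`, so (i) says `[K,K] = [M,M]`
whenever `K ⋖ M ⋖ L`. This holds because an element of `M` acts on `K/[K,K]` preserving every
hyperplane, so by scalars, and nilpotently, so by zero.

Conversely, (i) puts `[M,M]` inside every 3-maximal `S` below `M`. If `[M,M]` has codimension at
most 3, then `S = [M,M]`, an ideal because `M` is one. Otherwise `[L,L] = [M,M] ≤ S` by
`bracketSpan_top_le_of_bracketSpan_eq`. -/

open Module

/-! ### Derived algebras, ideals and covers in the subalgebra lattice -/

section LieSubalgebraLattice

variable {F L : Type*} [Field F] [LieRing L] [LieAlgebra F L]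

/-- The linear span of the brackets of elements of `K`, as a subspace of the ambient algebra. -/
def bracketSpan (K : LieSubalgebra F L) : Submodule F L :=
  Submodule.span F {z | ∃ a ∈ K, ∃ b ∈ K, ⁅a, b⁆ = z}

theorem lie_mem_bracketSpan {K : LieSubalgebra F L} {a b : L} (ha : a ∈ K) (hb : b ∈ K) :
    ⁅a, b⁆ ∈ bracketSpan K :=
  Submodule.subset_span ⟨a, ha, b, hb, rfl⟩

theorem bracketSpan_le_iff {K : LieSubalgebra F L} {V : Submodule F L} :
    bracketSpan K ≤ V ↔ ∀ a ∈ K, ∀ b ∈ K, ⁅a, b⁆ ∈ V := by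
  refine ⟨fun h a ha b hb => h (lie_mem_bracketSpan ha hb), fun h => ?_⟩
  refine Submodule.span_le.2 ?_
  rintro _ ⟨a, ha, b, hb, rfl⟩
  exact h a ha b hb

theorem bracketSpan_le (K : LieSubalgebra F L) : bracketSpan K ≤ K.toSubmodule :=
  bracketSpan_le_iff.2 fun _ ha _ hb => K.lie_mem ha hb

theorem bracketSpan_mono {K M : LieSubalgebra F L} (h : K ≤ M) : bracketSpan K ≤ bracketSpan M :=
  bracketSpan_le_iff.2 fun _ ha _ hb => lie_mem_bracketSpan (h ha) (h hb)

theorem lie_mem_bracketSpan_of_forall {K : LieSubalgebra F L} {x : L}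
    (hx : ∀ s ∈ K, ⁅x, s⁆ ∈ K) {d : L} (hd : d ∈ bracketSpan K) : ⁅x, d⁆ ∈ bracketSpan K := by
  induction hd using Submodule.span_induction with
  | mem d hd =>
    obtain ⟨a, ha, b, hb, rfl⟩ := hd
    rw [leibniz_lie]
    exact add_mem (lie_mem_bracketSpan (hx a ha) hb) (lie_mem_bracketSpan ha (hx b hb))
  | zero => simp
  | add a b _ _ ha hb => rw [lie_add]; exact add_mem ha hb
  | smul c a _ ha => rw [lie_smul]; exact Submodule.smul_mem _ c ha

/-- A linear subspace closed under the bracket, as a Lie subalgebra. -/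
def Submodule.toLieSubalgebraOfLieMem (V : Submodule F L) (h : ∀ a ∈ V, ∀ b ∈ V, ⁅a, b⁆ ∈ V) :
    LieSubalgebra F L :=
  { V with lie_mem' := fun {a b} ha hb => h a ha b hb }

theorem exists_toSubmodule_eq_sup_span {S : LieSubalgebra F L} {x : L}
    (hx : ∀ s ∈ S, ⁅x, s⁆ ∈ S) :
    ∃ T : LieSubalgebra F L, T.toSubmodule = S.toSubmodule ⊔ Submodule.span F {x} := by
  have hx' : x ∈ S.normalizer := S.mem_normalizer_iff x |>.2 hx
  refine ⟨Submodule.toLieSubalgebraOfLieMem _ fun a ha b hb => ?_, rfl⟩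
  rw [sup_comm] at ha hb
  rw [sup_comm]
  exact LieSubalgebra.lie_mem_sup_of_mem_normalizer hx' ha hb

theorem exists_toSubmodule_eq_span (x : L) :
    ∃ T : LieSubalgebra F L, T.toSubmodule = Submodule.span F {x} := by
  obtain ⟨T, hT⟩ := exists_toSubmodule_eq_sup_span (F := F) (S := ⊥) (x := x)
    (fun s hs => by rw [LieSubalgebra.mem_bot] at hs; simp [hs])
  exact ⟨T, by simpa using hT⟩

/-- A subalgebra stable under all inner derivations of `L`. -/
def LieSubalgebra.IsIdeal (K : LieSubalgebra F L) : Prop :=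
  ∀ x y : L, y ∈ K → ⁅x, y⁆ ∈ K

theorem LieSubalgebra.isIdeal_iff_exists {K : LieSubalgebra F L} :
    (∃ I : LieIdeal F L, LieIdeal.toLieSubalgebra F L I = K) ↔ K.IsIdeal :=
  LieSubalgebra.exists_lieIdeal_coe_eq_iff F K

theorem LieSubalgebra.IsIdeal.lie_mem_right {K : LieSubalgebra F L} (hK : K.IsIdeal) {x y : L}
    (hx : x ∈ K) : ⁅x, y⁆ ∈ K := by
  rw [← lie_skew]
  exact K.neg_mem (hK y x hx)

theorem LieSubalgebra.IsIdeal.toSubmodule_sup {S : LieSubalgebra F L} (hS : S.IsIdeal)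
    (T : LieSubalgebra F L) : (S ⊔ T).toSubmodule = S.toSubmodule ⊔ T.toSubmodule := by
  refine le_antisymm ?_ (sup_le ((LieSubalgebra.toSubmodule_le_toSubmodule _ _).2 le_sup_left)
    ((LieSubalgebra.toSubmodule_le_toSubmodule _ _).2 le_sup_right))
  let U : LieSubalgebra F L := Submodule.toLieSubalgebraOfLieMem (S.toSubmodule ⊔ T.toSubmodule) (by
    intro a ha b hb
    obtain ⟨s, hs, t, ht, rfl⟩ := Submodule.mem_sup.1 ha
    obtain ⟨s', hs', t', ht', rfl⟩ := Submodule.mem_sup.1 hb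
    have h1 : ⁅s + t, s'⁆ ∈ S.toSubmodule := hS _ _ hs'
    have h2 : ⁅s, t'⁆ ∈ S.toSubmodule := hS.lie_mem_right hs
    have h3 : ⁅t, t'⁆ ∈ T.toSubmodule := T.lie_mem ht ht'
    rw [lie_add, add_lie s t t', ← add_assoc]
    exact Submodule.add_mem_sup (add_mem h1 h2) h3)
  have h : S ⊔ T ≤ U := sup_le ((LieSubalgebra.toSubmodule_le_toSubmodule _ _).1 le_sup_left)
    ((LieSubalgebra.toSubmodule_le_toSubmodule _ _).1 le_sup_right)
  exact (LieSubalgebra.toSubmodule_le_toSubmodule _ _).2 h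

theorem LieSubalgebra.IsIdeal.sup {S T : LieSubalgebra F L} (hS : S.IsIdeal) (hT : T.IsIdeal) :
    (S ⊔ T).IsIdeal := by
  intro x y hy
  rw [← LieSubalgebra.mem_toSubmodule, hS.toSubmodule_sup] at hy ⊢
  obtain ⟨s, hs, t, ht, rfl⟩ := Submodule.mem_sup.1 hy
  rw [lie_add]
  exact Submodule.add_mem_sup (hS x s hs) (hT x t ht)

/-- An algebra covering two distinct ideals of `L` is an ideal of `L`. -/
theorem LieSubalgebra.IsIdeal.of_covBy_of_covBy {S T K : LieSubalgebra F L} (hS : S.IsIdeal)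
    (hT : T.IsIdeal) (hSK : S ⋖ K) (hTK : T ⋖ K) (hne : S ≠ T) : K.IsIdeal := by
  rw [← hSK.wcovBy.sup_eq hTK.wcovBy hne]
  exact hS.sup hT

theorem isIdeal_of_bracketSpan_top_le {S : LieSubalgebra F L}
    (h : bracketSpan (⊤ : LieSubalgebra F L) ≤ S.toSubmodule) : S.IsIdeal :=
  fun _ _ _ => h (lie_mem_bracketSpan (LieSubalgebra.mem_top _) (LieSubalgebra.mem_top _))

theorem LieSubalgebra.finrank_top' : finrank F (⊤ : LieSubalgebra F L) = finrank F L :=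
  _root_.finrank_top F L

variable [FiniteDimensional F L]

theorem LieSubalgebra.finrank_mono {S K : LieSubalgebra F L} (h : S ≤ K) :
    finrank F S ≤ finrank F K :=
  Submodule.finrank_mono ((LieSubalgebra.toSubmodule_le_toSubmodule _ _).2 h)

theorem LieSubalgebra.finrank_lt {S K : LieSubalgebra F L} (h : S < K) :
    finrank F S < finrank F K :=
  Submodule.finrank_lt_finrank_of_lt (s := S.toSubmodule) (t := K.toSubmodule) h

theorem LieSubalgebra.eq_of_le_of_finrank_le' {S K : LieSubalgebra F L} (h : S ≤ K)
    (h' : finrank F K ≤ finrank F S) : S = K := by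
  by_contra hne
  have := LieSubalgebra.finrank_lt (lt_of_le_of_ne h hne)
  omega

theorem LieSubalgebra.covBy_of_finrank {S K : LieSubalgebra F L} (h : S ≤ K)
    (h' : finrank F S + 1 = finrank F K) : S ⋖ K := by
  refine ⟨lt_of_le_of_ne h fun e => by subst e; omega, fun U h1 h2 => ?_⟩
  have := LieSubalgebra.finrank_lt h1
  have := LieSubalgebra.finrank_lt h2
  omega

theorem finrank_sup_span {V : Submodule F L} {x : L} (hx : x ∉ V) :
    finrank F ↥(V ⊔ Submodule.span F {x}) = finrank F V + 1 := by
  have hx0 : x ≠ 0 := fun h => hx (h ▸ V.zero_mem)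
  have h := Submodule.finrank_sup_add_finrank_inf_eq V (Submodule.span F {x})
  have hd : V ⊓ Submodule.span F {x} = ⊥ := by
    rw [← disjoint_iff]
    exact (Submodule.disjoint_span_singleton' hx0).2 hx
  rw [hd, finrank_bot, finrank_span_singleton hx0] at h
  exact h

/-- A subalgebra `K` has hyperplanes containing a given subspace which contains all brackets of
`K`, avoiding a given element. -/
theorem exists_hyperplane_notMem {K : LieSubalgebra F L} {V : Submodule F L}
    (hV : bracketSpan K ≤ V) {y : L} (hyK : y ∈ K) (hyV : y ∉ V) :
    ∃ T : LieSubalgebra F L, T ⋖ K ∧ finrank F T + 1 = finrank F K ∧ y ∉ T ∧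
      K.toSubmodule ⊓ V ≤ T.toSubmodule := by
  obtain ⟨f, hfy, hf⟩ := Submodule.exists_le_ker_of_notMem hyV
  let T : LieSubalgebra F L := Submodule.toLieSubalgebraOfLieMem
    (K.toSubmodule ⊓ LinearMap.ker f) fun a ha b hb =>
      ⟨K.lie_mem ha.1 hb.1, hf (hV (lie_mem_bracketSpan ha.1 hb.1))⟩
  have hTK : T ≤ K := fun a ha => ha.1
  have hr : finrank F T + 1 = finrank F K := by
    have hg : f.domRestrict K.toSubmodule ≠ 0 := fun h =>
      hfy (by simpa using LinearMap.congr_fun h ⟨y, hyK⟩)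
    have h1 := Dual.finrank_ker_add_one_of_ne_zero hg
    have h2 : (LinearMap.ker (f.domRestrict K.toSubmodule)).map K.toSubmodule.subtype =
        T.toSubmodule := by
      ext z
      change _ ↔ z ∈ K.toSubmodule ⊓ LinearMap.ker f
      simp [and_comm]
    have h3 := Submodule.finrank_map_subtype_eq K.toSubmodule
      (LinearMap.ker (f.domRestrict K.toSubmodule))
    rw [h2] at h3
    exact (congrArg (· + 1) h3).trans h1
  exact ⟨T, LieSubalgebra.covBy_of_finrank hTK hr, hr, fun h => hfy h.2,
    fun z hz => ⟨hz.1, hf hz.2⟩⟩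

/-- The line through a vector outside one maximal subalgebra of `K` is proper in `K`, so it lies in
another. -/
theorem exists_two_covBy {K : LieSubalgebra F L} (hK : 2 ≤ finrank F K) :
    ∃ S T : LieSubalgebra F L, S ⋖ K ∧ T ⋖ K ∧ S ≠ T := by
  have hbot : (⊥ : LieSubalgebra F L) < K := by
    refine bot_lt_iff_ne_bot.2 fun h => ?_
    have h0 : finrank F (⊥ : LieSubalgebra F L) = 0 := finrank_bot F L
    rw [h, h0] at hK
    omega
  obtain ⟨S, -, hS⟩ := exists_le_covBy_of_lt hbot
  obtain ⟨x, hxK, hxS⟩ := SetLike.exists_of_lt hS.lt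
  obtain ⟨X, hX⟩ := exists_toSubmodule_eq_span (F := F) x
  have hxX : x ∈ X := by
    rw [← LieSubalgebra.mem_toSubmodule, hX]; exact Submodule.mem_span_singleton_self x
  have hXK : X ≤ K := by
    rw [← LieSubalgebra.toSubmodule_le_toSubmodule, hX]
    exact (Submodule.span_singleton_le_iff_mem _ _).2 hxK
  have hXr : finrank F X ≤ 1 := by
    change finrank F X.toSubmodule ≤ 1
    rw [hX]
    exact (finrank_span_le_card {x}).trans (by simp)
  obtain ⟨T, hXT, hT⟩ := exists_le_covBy_of_lt
    (lt_of_le_of_ne hXK fun h => by rw [h] at hXr; omega)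
  exact ⟨S, T, hS, hT, fun h => hxS (h ▸ hXT hxX)⟩

theorem exists_hyperplane_of_isSolvable [LieAlgebra.IsSolvable L] {K : LieSubalgebra F L}
    (hK : 1 ≤ finrank F K) :
    ∃ T : LieSubalgebra F L, T ⋖ K ∧ finrank F T + 1 = finrank F K := by
  have hne : ¬ K.toSubmodule ≤ bracketSpan K := by
    intro hle
    have key : ∀ n, K.toSubmodule ≤ (LieAlgebra.derivedSeries F L n).toSubmodule := by
      intro n
      induction n with
      | zero => intro x _; simp
      | succ n ih =>
        refine hle.trans (bracketSpan_le_iff.2 fun a ha b hb => ?_)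
        rw [LieAlgebra.derivedSeries_def, LieAlgebra.derivedSeriesOfIdeal_succ]
        exact LieSubmodule.lie_mem_lie (ih ha) (ih hb)
    obtain ⟨n, hn⟩ := LieAlgebra.IsSolvable.solvable (R := F) (L := L)
    have h0 := key n
    rw [hn, LieSubmodule.bot_toSubmodule, le_bot_iff] at h0
    change 1 ≤ finrank F K.toSubmodule at hK
    rw [h0, finrank_bot] at hK
    omega
  obtain ⟨y, hy, hyD⟩ := SetLike.not_le_iff_exists.1 hne
  obtain ⟨T, hT, hr, -⟩ := exists_hyperplane_notMem le_rfl hy hyD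
  exact ⟨T, hT, hr⟩

/-- A finite-dimensional Lie algebra all of whose maximal subalgebras are ideals is nilpotent. -/
theorem isNilpotent_of_forall_isCoatom_isIdeal
    (h : ∀ M : LieSubalgebra F L, IsCoatom M → M.IsIdeal) : LieRing.IsNilpotent L := by
  rw [LieAlgebra.isNilpotent_iff_forall (R := F)]
  intro x
  have htop : LieSubalgebra.engel F x = ⊤ := by
    by_contra hne
    obtain ⟨M, hM, hxM⟩ := (eq_top_or_exists_le_coatom (LieSubalgebra.engel F x)).resolve_left hne
    -- Subalgebras containing an Engel subalgebra are self-normalizing, but the ideal `M` is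
    -- normalized by all of `L`.
    have h1 := LieSubalgebra.normalizer_eq_self_of_engel_le M x hxM
    refine hM.1 (eq_top_iff.2 fun y _ => ?_)
    rw [← h1, LieSubalgebra.mem_normalizer_iff]
    exact fun z hz => h M hM y z hz
  rw [Module.End.isNilpotent_iff_of_finite]
  intro y
  exact (LieSubalgebra.mem_engel_iff F x y).1 (htop ▸ LieSubalgebra.mem_top y)

end LieSubalgebraLattice

/-! ### Covers and Frattini ideals in nilpotent algebras -/

section Nilpotent

variable {F L : Type*} [Field F] [LieRing L] [LieAlgebra F L]

/-- The normalizer condition: take `x` in the last lower central term whose intersection with `K` is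
not inside `S`; brackets with `S` fall into the next term. -/
theorem exists_lie_mem_of_lt [LieRing.IsNilpotent L] {S K : LieSubalgebra F L} (h : S < K) :
    ∃ x ∈ K, x ∉ S ∧ ∀ s ∈ S, ⁅x, s⁆ ∈ S := by
  classical
  let P : ℕ → Prop := fun n =>
    K.toSubmodule ⊓ (LieModule.lowerCentralSeries F L L n).toSubmodule ≤ S.toSubmodule
  have hP : ∃ n, P n := by
    obtain ⟨n, hn⟩ := LieModule.IsNilpotent.nilpotent F L L
    exact ⟨n, by simp [P, hn]⟩
  have h0 : Nat.find hP ≠ 0 := by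
    intro h0
    have h1 : P 0 := h0 ▸ Nat.find_spec hP
    refine h.not_ge fun x hx => ?_
    exact h1 ⟨hx, by simp⟩
  obtain ⟨n, hn⟩ := Nat.exists_eq_succ_of_ne_zero h0
  have hn1 : P (n + 1) := by
    have h1 := Nat.find_spec hP
    rwa [hn] at h1
  have hn0 : ¬ P n := Nat.find_min hP (by omega)
  obtain ⟨x, ⟨hxK, hxn⟩, hxS⟩ := SetLike.not_le_iff_exists.1 hn0
  refine ⟨x, hxK, hxS, fun s hs => hn1 ⟨K.lie_mem hxK (h.le hs), ?_⟩⟩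
  have h2 : ⁅s, x⁆ ∈ LieModule.lowerCentralSeries F L L (n + 1) := by
    rw [LieModule.lowerCentralSeries_succ]
    exact LieSubmodule.lie_mem_lie (LieSubmodule.mem_top s) hxn
  rw [← lie_skew]
  exact neg_mem h2

theorem CovBy.exists_toSubmodule_eq_sup_span [LieRing.IsNilpotent L] {S K : LieSubalgebra F L}
    (h : S ⋖ K) : ∃ x ∈ K, x ∉ S ∧ (∀ s ∈ S, ⁅x, s⁆ ∈ S) ∧
      K.toSubmodule = S.toSubmodule ⊔ Submodule.span F {x} := by
  obtain ⟨x, hxK, hxS, hx⟩ := exists_lie_mem_of_lt h.lt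
  obtain ⟨T, hT⟩ := _root_.exists_toSubmodule_eq_sup_span hx
  have hxT : x ∈ T.toSubmodule := by
    rw [hT]; exact Submodule.mem_sup_right (Submodule.mem_span_singleton_self x)
  have hST : S ≤ T := by
    rw [← LieSubalgebra.toSubmodule_le_toSubmodule, hT]; exact le_sup_left
  have hTK : T ≤ K := by
    rw [← LieSubalgebra.toSubmodule_le_toSubmodule, hT]
    exact sup_le h.le ((Submodule.span_singleton_le_iff_mem _ _).2 hxK)
  have hTe : T = K := (h.eq_or_eq hST hTK).resolve_left fun e => hxS (e ▸ hxT)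
  exact ⟨x, hxK, hxS, hx, hTe ▸ hT⟩

/-- If `K = S + Fx`, then every bracket of elements of `K` is the sum of a bracket of elements of
`S` and the bracket of `x` with an element of `S`. -/
theorem bracketSpan_le_of_sup_span {S K : LieSubalgebra F L} {x : L} {V : Submodule F L}
    (hK : K.toSubmodule = S.toSubmodule ⊔ Submodule.span F {x}) (hS : bracketSpan S ≤ V)
    (hx : ∀ s ∈ S, ⁅x, s⁆ ∈ V) : bracketSpan K ≤ V := by
  refine bracketSpan_le_iff.2 fun a ha b hb => ?_
  rw [← LieSubalgebra.mem_toSubmodule, hK] at ha hb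
  obtain ⟨s, hs, _, hc, rfl⟩ := Submodule.mem_sup.1 ha
  obtain ⟨c, rfl⟩ := Submodule.mem_span_singleton.1 hc
  obtain ⟨t, ht, _, hd, rfl⟩ := Submodule.mem_sup.1 hb
  obtain ⟨d, rfl⟩ := Submodule.mem_span_singleton.1 hd
  have e : ⁅s + c • x, t + d • x⁆ = ⁅s, t⁆ + c • ⁅x, t⁆ - d • ⁅x, s⁆ := by
    rw [← lie_skew x s]
    simp only [lie_add, add_lie, lie_smul, smul_lie, lie_self, smul_zero, smul_neg]
    module
  rw [e]
  exact sub_mem (add_mem (hS (lie_mem_bracketSpan hs ht)) (V.smul_mem _ (hx t ht)))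
    (V.smul_mem _ (hx s hs))

theorem CovBy.bracketSpan_le [LieRing.IsNilpotent L] {S K : LieSubalgebra F L} (h : S ⋖ K) :
    bracketSpan K ≤ S.toSubmodule := by
  obtain ⟨x, -, -, hx, hK⟩ := h.exists_toSubmodule_eq_sup_span
  exact bracketSpan_le_of_sup_span hK (_root_.bracketSpan_le S) hx

theorem isIdeal_of_isCoatom [LieRing.IsNilpotent L] {M : LieSubalgebra F L} (h : IsCoatom M) :
    M.IsIdeal :=
  isIdeal_of_bracketSpan_top_le h.covBy_top.bracketSpan_le

variable [FiniteDimensional F L]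

theorem CovBy.finrank_add_one [LieRing.IsNilpotent L] {S K : LieSubalgebra F L} (h : S ⋖ K) :
    finrank F S + 1 = finrank F K := by
  obtain ⟨x, -, hxS, -, hK⟩ := h.exists_toSubmodule_eq_sup_span
  have h1 := finrank_sup_span (V := S.toSubmodule) hxS
  rw [← hK] at h1
  exact h1.symm

theorem frattiniIdeal_toSubmodule [LieRing.IsNilpotent L] :
    (frattiniIdeal F L).toSubmodule = bracketSpan (⊤ : LieSubalgebra F L) := by
  refine le_antisymm (fun y hy => ?_) ?_
  · by_contra hyD
    obtain ⟨T, hT, -, hyT, -⟩ := exists_hyperplane_notMem le_rfl (LieSubalgebra.mem_top y) hyD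
    have h1 : y ∈ maximalSubalgebrasInf F L := (frattiniIdeal_isGreatest F L).1 hy
    exact hyT ((sInf_le (show T ∈ {M | IsCoatom M} from covBy_top_iff.1 hT) :
      maximalSubalgebrasInf F L ≤ T) h1)
  · let I : LieIdeal F L :=
      { bracketSpan (⊤ : LieSubalgebra F L) with
        lie_mem := fun {x y} _ =>
          lie_mem_bracketSpan (LieSubalgebra.mem_top x) (LieSubalgebra.mem_top y) }
    have hI : LieIdeal.toLieSubalgebra F L I ≤ maximalSubalgebrasInf F L :=
      le_sInf fun M hM => (show IsCoatom M from hM).covBy_top.bracketSpan_le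
    exact (frattiniIdeal_isGreatest F L).2 hI

theorem frattiniOf_toSubmodule [LieRing.IsNilpotent L] (K : LieSubalgebra F L) :
    (frattiniOf K).toSubmodule = bracketSpan K := by
  have : LieRing.IsNilpotent K :=
    Function.Injective.lieAlgebra_isNilpotent (f := K.incl) Subtype.val_injective
  have h1 : (frattiniOf K).toSubmodule =
      (frattiniIdeal F K).toSubmodule.map (K.incl : K →ₗ[F] L) := rfl
  rw [h1, frattiniIdeal_toSubmodule, bracketSpan, bracketSpan, Submodule.map_span]
  congr 1
  ext z
  constructor
  · rintro ⟨_, ⟨a, -, b, -, rfl⟩, rfl⟩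
    exact ⟨a, a.2, b, b.2, rfl⟩
  · rintro ⟨a, ha, b, hb, rfl⟩
    exact ⟨⁅(⟨a, ha⟩ : K), (⟨b, hb⟩ : K)⁆,
      ⟨_, LieSubalgebra.mem_top _, _, LieSubalgebra.mem_top _, rfl⟩, rfl⟩

theorem frattiniOf_eq_iff [LieRing.IsNilpotent L] {K M : LieSubalgebra F L} :
    frattiniOf K = frattiniOf M ↔ bracketSpan K = bracketSpan M := by
  rw [← frattiniOf_toSubmodule, ← frattiniOf_toSubmodule, LieSubalgebra.toSubmodule_inj]

end Nilpotent

/-! ### Chains of maximal subalgebras -/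

section NMaximal

variable {F L : Type*} [Field F] [LieRing L] [LieAlgebra F L]

theorem isNMaximalSubalgebra_two_iff {K : LieSubalgebra F L} :
    IsNMaximalSubalgebra F 2 K ↔ ∃ M, K ⋖ M ∧ M ⋖ ⊤ := by
  constructor
  · rintro ⟨c, rfl, h, hc⟩
    exact ⟨c 1, hc 0, h ▸ hc 1⟩
  · rintro ⟨M, hK, hM⟩
    refine ⟨![K, M, ⊤], rfl, rfl, fun i => ?_⟩
    fin_cases i
    exacts [hK, hM]

theorem isNMaximalSubalgebra_three_iff {S : LieSubalgebra F L} :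
    IsNMaximalSubalgebra F 3 S ↔ ∃ K M, S ⋖ K ∧ K ⋖ M ∧ M ⋖ ⊤ := by
  constructor
  · rintro ⟨c, rfl, h, hc⟩
    exact ⟨c 1, c 2, hc 0, hc 1, h ▸ hc 2⟩
  · rintro ⟨K, M, hS, hK, hM⟩
    refine ⟨![S, K, M, ⊤], rfl, rfl, fun i => ?_⟩
    fin_cases i
    exacts [hS, hK, hM]

variable [FiniteDimensional F L]

/-- If all `3`-maximal subalgebras are ideals, then so are the `2`-maximal subalgebras of dimension
at least two. -/
theorem isIdeal_of_covBy_covBy_top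
    (h : ∀ S K M : LieSubalgebra F L, S ⋖ K → K ⋖ M → M ⋖ ⊤ → S.IsIdeal)
    {K M : LieSubalgebra F L} (hKM : K ⋖ M) (hM : M ⋖ ⊤) (hK : 2 ≤ finrank F K) : K.IsIdeal := by
  obtain ⟨S, T, hS, hT, hne⟩ := exists_two_covBy hK
  exact (h S K M hS hKM hM).of_covBy_of_covBy (h T K M hT hKM hM) hS hT hne

/-- In dimension at least 3, `M` would cover two distinct ideals: a hyperplane `K`, and `T + Fx`
with `T` a hyperplane of `K` and `x` outside `K`. -/
theorem finrank_le_two_of_not_isIdeal [LieAlgebra.IsSolvable L]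
    (h : ∀ S K M : LieSubalgebra F L, S ⋖ K → K ⋖ M → M ⋖ ⊤ → S.IsIdeal)
    {M : LieSubalgebra F L} (hM : M ⋖ ⊤) (hMI : ¬ M.IsIdeal) : finrank F M ≤ 2 := by
  by_contra! hM3
  obtain ⟨K, hKM, hK⟩ := exists_hyperplane_of_isSolvable (show 1 ≤ finrank F M by omega)
  have hKI := isIdeal_of_covBy_covBy_top h hKM hM (by omega)
  obtain ⟨T, hTK, hT⟩ := exists_hyperplane_of_isSolvable (show 1 ≤ finrank F K by omega)
  have hTI := h T K M hTK hKM hM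
  obtain ⟨x, hxM, hxK⟩ := SetLike.exists_of_lt hKM.lt
  obtain ⟨U, hU⟩ := exists_toSubmodule_eq_sup_span (S := T) (x := x) fun s hs => hTI x s hs
  have hxU : x ∈ U.toSubmodule := by
    rw [hU]; exact Submodule.mem_sup_right (Submodule.mem_span_singleton_self x)
  have hUM : U ≤ M := by
    rw [← LieSubalgebra.toSubmodule_le_toSubmodule, hU]
    exact sup_le (hTK.le.trans hKM.le) ((Submodule.span_singleton_le_iff_mem _ _).2 hxM)
  have hUr : finrank F U = finrank F T + 1 := by
    have h1 := finrank_sup_span (V := T.toSubmodule) (x := x) fun hx => hxK (hTK.le hx)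
    rw [← hU] at h1
    exact h1
  have hUcov : U ⋖ M := LieSubalgebra.covBy_of_finrank hUM (by omega)
  have hUI := isIdeal_of_covBy_covBy_top h hUcov hM (by omega)
  exact hMI (hKI.of_covBy_of_covBy hUI hKM hUcov fun e => hxK (e ▸ hxU))

theorem LieSubalgebra.IsIdeal.le_of_finrank_add_lt {S M : LieSubalgebra F L} (hS : S.IsIdeal)
    (hM : IsCoatom M) (hr : finrank F S + finrank F M < finrank F L) : S ≤ M := by
  by_contra hSM
  have htop : S ⊔ M = ⊤ := hM.2 _ (lt_of_le_of_ne le_sup_right fun e => hSM (e ▸ le_sup_left))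
  have h1 := hS.toSubmodule_sup M
  rw [htop, LieSubalgebra.top_toSubmodule] at h1
  have h2 := Submodule.finrank_add_le_finrank_add_finrank S.toSubmodule M.toSubmodule
  rw [← h1, finrank_top] at h2
  exact absurd hr (not_lt.2 h2)

/-- A solvable Lie algebra of dimension at least four all of whose `3`-maximal subalgebras are
ideals is nilpotent. -/
theorem isNilpotent_of_three_maximal_isIdeal [LieAlgebra.IsSolvable L]
    (h : ∀ S K M : LieSubalgebra F L, S ⋖ K → K ⋖ M → M ⋖ ⊤ → S.IsIdeal)
    (hL : 4 ≤ finrank F L) : LieRing.IsNilpotent L := by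
  refine isNilpotent_of_forall_isCoatom_isIdeal (F := F) fun M hM => ?_
  by_contra hMI
  have hM2 := finrank_le_two_of_not_isIdeal h hM.covBy_top hMI
  have htop := LieSubalgebra.finrank_top' (F := F) (L := L)
  obtain ⟨Q, hQ, hQr⟩ := exists_hyperplane_of_isSolvable
    (show 1 ≤ finrank F (⊤ : LieSubalgebra F L) by omega)
  obtain ⟨R, hR, hRr⟩ := exists_hyperplane_of_isSolvable (show 1 ≤ finrank F Q by omega)
  have hRI := isIdeal_of_covBy_covBy_top h hR hQ (by omega)
  -- Here `dim S ≤ dim L - 3` and `dim M ≤ 2`, so the ideal `S` cannot supplement `M`.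
  have hle : ∀ S, S ⋖ R → S ≤ M := fun S hS =>
    (h S R Q hS hR hQ).le_of_finrank_add_lt hM (by
      have := LieSubalgebra.finrank_lt hS.lt
      omega)
  obtain ⟨S, T, hS, hT, hne⟩ := exists_two_covBy (K := R) (by omega)
  have hRM : R ≤ M := by
    rw [← hS.wcovBy.sup_eq hT.wcovBy hne]
    exact sup_le (hle S hS) (hle T hT)
  exact hMI (LieSubalgebra.eq_of_le_of_finrank_le' hRM (by omega) ▸ hRI)

theorem bracketSpan_le_bracketSpan_of_three_maximal_isIdeal [LieRing.IsNilpotent L]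
    (h : ∀ S K M : LieSubalgebra F L, S ⋖ K → K ⋖ M → M ⋖ ⊤ → S.IsIdeal)
    {K M : LieSubalgebra F L} (hKM : K ⋖ M) (hM : M ⋖ ⊤) : bracketSpan M ≤ bracketSpan K := by
  obtain ⟨x, -, -, hx, hMe⟩ := hKM.exists_toSubmodule_eq_sup_span
  refine bracketSpan_le_of_sup_span hMe le_rfl fun k hk => ?_
  have hstab : ∀ d ∈ bracketSpan K, ⁅x, d⁆ ∈ bracketSpan K := fun d hd =>
    lie_mem_bracketSpan_of_forall hx hd
  -- Otherwise some hyperplane of `K` contains `[K,K]` and `k` but not `⁅x, k⁆`; being 3-maximal, it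
  -- is an ideal.
  have hmem : ⁅x, k⁆ ∈ bracketSpan K ⊔ Submodule.span F {k} := by
    by_contra hnot
    obtain ⟨T, hT, -, hxT, hle⟩ := exists_hyperplane_notMem
      (le_sup_left : bracketSpan K ≤ bracketSpan K ⊔ Submodule.span F {k}) (hx k hk) hnot
    have hkT : k ∈ T :=
      hle ⟨hk, Submodule.mem_sup_right (Submodule.mem_span_singleton_self k)⟩
    exact hxT (h T K M hT hKM hM x k hkT)
  obtain ⟨d, hd, _, hc, hdc⟩ := Submodule.mem_sup.1 hmem
  obtain ⟨c, rfl⟩ := Submodule.mem_span_singleton.1 hc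
  by_cases hc0 : c = 0
  · rw [← hdc, hc0, zero_smul, add_zero]
    exact hd
  obtain ⟨n, hn⟩ := LieModule.exists_forall_pow_toEnd_eq_zero F L L
  -- Modulo `[K,K]`, `k` is an eigenvector of the nilpotent map `ad x` with eigenvalue `c ≠ 0`, so
  -- `k` vanishes there.
  have hpow : ∀ m : ℕ, (LieModule.toEnd F L L x ^ m) k - c ^ m • k ∈ bracketSpan K := by
    intro m
    induction m with
    | zero => simp
    | succ m ih =>
      have e : (LieModule.toEnd F L L x ^ (m + 1)) k - c ^ (m + 1) • k =
          ⁅x, (LieModule.toEnd F L L x ^ m) k - c ^ m • k⁆ + c ^ m • d := by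
        rw [pow_succ', Module.End.mul_apply, LieModule.toEnd_apply_apply, lie_sub, lie_smul, ← hdc,
          pow_succ, mul_smul, smul_add]
        abel
      rw [e]
      exact add_mem (hstab _ ih) (Submodule.smul_mem _ _ hd)
  have hkD : k ∈ bracketSpan K := by
    have h1 := hpow n
    rw [hn x, LinearMap.zero_apply, zero_sub] at h1
    have h2 := neg_mem h1
    rw [neg_neg] at h2
    exact (Submodule.smul_mem_iff _ (pow_ne_zero n hc0)).1 h2
  exact hstab k hkD

theorem inf_covBy_of_covBy_top [LieRing.IsNilpotent L] {A B : LieSubalgebra F L}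
    (hA : A ⋖ ⊤) (hB : B ⋖ ⊤) (hne : A ≠ B) : A ⊓ B ⋖ A ∧ A ⊓ B ⋖ B := by
  have h1 := Submodule.finrank_sup_add_finrank_inf_eq A.toSubmodule B.toSubmodule
  rw [← (isIdeal_of_isCoatom (covBy_top_iff.1 hA)).toSubmodule_sup, hA.wcovBy.sup_eq hB.wcovBy hne] at h1
  have h2 : finrank F (⊤ : LieSubalgebra F L) + finrank F ↥(A ⊓ B) =
    finrank F A + finrank F B := h1
  have hAr := hA.finrank_add_one
  have hBr := hB.finrank_add_one
  exact ⟨LieSubalgebra.covBy_of_finrank inf_le_left (by omega),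
    LieSubalgebra.covBy_of_finrank inf_le_right (by omega)⟩

/-- If the derived algebras of the maximal subalgebras agree with those of the `2`-maximal
subalgebras which they contain, then the derived algebra of a maximal subalgebra contains that of
`L`, unless it has codimension at most three. -/
theorem bracketSpan_top_le_of_bracketSpan_eq [LieRing.IsNilpotent L]
    (h : ∀ K M : LieSubalgebra F L, K ⋖ M → M ⋖ ⊤ → bracketSpan K = bracketSpan M)
    {M : LieSubalgebra F L} (hM : M ⋖ ⊤)
    (hr : finrank F (bracketSpan M) + 4 ≤ finrank F L) :
    bracketSpan (⊤ : LieSubalgebra F L) ≤ bracketSpan M := by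
  have htop := LieSubalgebra.finrank_top' (F := F) (L := L)
  obtain ⟨T, hT, hne⟩ : ∃ T : LieSubalgebra F L, T ⋖ ⊤ ∧ M ≠ T := by
    obtain ⟨S, T, hS, hT, hne⟩ := exists_two_covBy (K := (⊤ : LieSubalgebra F L)) (by omega)
    by_cases hMS : M = S
    · exact ⟨T, hT, hMS ▸ hne⟩
    · exact ⟨S, hS, hMS⟩
  have hZM := (inf_covBy_of_covBy_top hM hT hne).1
  have hZT := (inf_covBy_of_covBy_top hM hT hne).2
  -- `L = M + T`, and `M`, `T` and `M ⊓ T` share one derived algebra.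
  have hZ : ∀ u : L, ∀ z ∈ M ⊓ T, ⁅u, z⁆ ∈ bracketSpan M := by
    intro u z hz
    have hu : u ∈ (M ⊔ T).toSubmodule := by
      rw [hM.wcovBy.sup_eq hT.wcovBy hne]; exact LieSubalgebra.mem_top u
    rw [(isIdeal_of_isCoatom (covBy_top_iff.1 hM)).toSubmodule_sup] at hu
    obtain ⟨s, hs, t, ht, rfl⟩ := Submodule.mem_sup.1 hu
    rw [add_lie]
    refine add_mem (lie_mem_bracketSpan hs hz.1) ?_
    rw [← h _ _ hZM hM, h _ _ hZT hT]
    exact lie_mem_bracketSpan ht hz.2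
  obtain ⟨x, -, -, -, hMx⟩ := hZM.exists_toSubmodule_eq_sup_span
  obtain ⟨y, -, -, -, hLy⟩ := hM.exists_toSubmodule_eq_sup_span
  have hV : bracketSpan (⊤ : LieSubalgebra F L) ≤ bracketSpan M ⊔ Submodule.span F {⁅y, x⁆} := by
    refine bracketSpan_le_of_sup_span hLy le_sup_left fun s hs => ?_
    rw [← LieSubalgebra.mem_toSubmodule, hMx] at hs
    obtain ⟨z, hz, _, hc, rfl⟩ := Submodule.mem_sup.1 hs
    obtain ⟨c, rfl⟩ := Submodule.mem_span_singleton.1 hc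
    rw [lie_add, lie_smul]
    exact Submodule.add_mem_sup (hZ y z hz)
      (Submodule.smul_mem _ c (Submodule.mem_span_singleton_self _))
  have hVr : finrank F ↥(bracketSpan M ⊔ Submodule.span F {⁅y, x⁆}) ≤ finrank F (bracketSpan M) + 1 :=
    (Submodule.finrank_add_le_finrank_add_finrank _ _).trans
      (Nat.add_le_add_left ((finrank_span_le_card {⁅y, x⁆}).trans (by simp)) _)
  have hZr := hZM.finrank_add_one
  have hMr := hM.finrank_add_one
  -- `M ⊓ T` has codimension 2, hence dimension at least `dim [M,M] + 2`, one more than the bound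
  -- `hVr`.
  obtain ⟨z, hz, hzV⟩ : ∃ z ∈ M ⊓ T, z ∉ bracketSpan M ⊔ Submodule.span F {⁅y, x⁆} := by
    by_contra! hcon
    have h1 : finrank F ↥(M ⊓ T) ≤ _ :=
      Submodule.finrank_mono (s := (M ⊓ T).toSubmodule) (show _ ≤ _ from hcon)
    omega
  obtain ⟨W, hW, hWr, hzW, -⟩ := exists_hyperplane_notMem hV (LieSubalgebra.mem_top z) hzV
  have hWz : (⊤ : LieSubalgebra F L).toSubmodule = W.toSubmodule ⊔ Submodule.span F {z} := by
    refine (Submodule.eq_top_of_finrank_eq ?_).symm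
    rw [finrank_sup_span (V := W.toSubmodule) hzW, ← htop]
    exact hWr
  refine bracketSpan_le_of_sup_span hWz ?_ fun s _ => ?_
  · by_cases hWM : M = W
    · rw [hWM]
    · have h1 := inf_covBy_of_covBy_top hM hW hWM
      rw [← h _ _ h1.1 hM, h _ _ h1.2 hW]
  · rw [← lie_skew]
    exact neg_mem (hZ s z hz)

end NMaximal

theorem theoremt (F L : Type*) [Field F] [LieRing L] [LieAlgebra F L] [FiniteDimensional F L]
    [LieAlgebra.IsSolvable L] :
    (∀ J : LieSubalgebra F L, IsNMaximalSubalgebra F 3 J →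
        ∃ I : LieIdeal F L, LieIdeal.toLieSubalgebra F L I = J) ↔
      (LieRing.IsNilpotent L ∧
          ∀ K M : LieSubalgebra F L, IsNMaximalSubalgebra F 2 K → IsCoatom M → K ≤ M →
            frattiniOf K = frattiniOf M) ∨
        Module.finrank F L ≤ 3 := by
  have key : (∀ J : LieSubalgebra F L, IsNMaximalSubalgebra F 3 J →
        ∃ I : LieIdeal F L, LieIdeal.toLieSubalgebra F L I = J) ↔
      ∀ S K M : LieSubalgebra F L, S ⋖ K → K ⋖ M → M ⋖ ⊤ → S.IsIdeal := by
    simp only [isNMaximalSubalgebra_three_iff, LieSubalgebra.isIdeal_iff_exists]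
    exact ⟨fun h S K M hS hK hM => h S ⟨K, M, hS, hK, hM⟩,
      fun h S ⟨K, M, hS, hK, hM⟩ => h S K M hS hK hM⟩
  rw [key]
  constructor
  · intro h
    by_cases hL : finrank F L ≤ 3
    · exact Or.inr hL
    have hnil : LieRing.IsNilpotent L := isNilpotent_of_three_maximal_isIdeal h (by omega)
    refine Or.inl ⟨hnil, fun K M hK hM hKM => frattiniOf_eq_iff.2 ?_⟩
    obtain ⟨M', hKM', hM'⟩ := isNMaximalSubalgebra_two_iff.1 hK
    have h1 := hKM'.finrank_add_one
    have h2 := hM'.finrank_add_one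
    have h3 := hM.covBy_top.finrank_add_one
    -- The chain defining `K` may pass through another `M'`; codimensions still force a cover.
    have hcov : K ⋖ M := LieSubalgebra.covBy_of_finrank hKM (by omega)
    exact le_antisymm (bracketSpan_mono hKM)
      (bracketSpan_le_bracketSpan_of_three_maximal_isIdeal h hcov hM.covBy_top)
  · rintro (⟨hnil, hφ⟩ | hL) S K M hS hK hM
    · have h : ∀ K M : LieSubalgebra F L, K ⋖ M → M ⋖ ⊤ → bracketSpan K = bracketSpan M :=
        fun K M hK hM => frattiniOf_eq_iff.1 (hφ K M (isNMaximalSubalgebra_two_iff.2 ⟨M, hK, hM⟩)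
          (covBy_top_iff.1 hM) hK.le)
      have hMS : bracketSpan M ≤ S.toSubmodule := by
        rw [← h K M hK hM]
        exact hS.bracketSpan_le
      have hSr := hS.finrank_add_one
      have hKr := hK.finrank_add_one
      have hMr := hM.finrank_add_one
      have htop := LieSubalgebra.finrank_top' (F := F) (L := L)
      by_cases hr : finrank F (bracketSpan M) + 4 ≤ finrank F L
      · exact isIdeal_of_bracketSpan_top_le
          ((bracketSpan_top_le_of_bracketSpan_eq h hM hr).trans hMS)
      -- `S` has codimension exactly 3.
      · have hSe : bracketSpan M = S.toSubmodule :=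
          Submodule.eq_of_le_of_finrank_le hMS (by change finrank F S ≤ _; omega)
        have hMI := isIdeal_of_isCoatom (covBy_top_iff.1 hM)
        intro x s hs
        rw [← LieSubalgebra.mem_toSubmodule, ← hSe] at hs ⊢
        exact lie_mem_bracketSpan_of_forall (hMI x) hs
    · have h1 := LieSubalgebra.finrank_lt hS.lt
      have h2 := LieSubalgebra.finrank_lt hK.lt
      have h3 := LieSubalgebra.finrank_lt hM.lt
      have htop := LieSubalgebra.finrank_top' (F := F) (L := L)
      have hS0 : S = ⊥ := (LieSubalgebra.eq_of_le_of_finrank_le' bot_le (by omega)).symm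
      intro x s hs
      rw [hS0, LieSubalgebra.mem_bot] at hs ⊢
      rw [hs, lie_zero]
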